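/- For $n\ge 0$ let $J_n=\{\top,\bot,f_0,\dots,f_n,t_0,\dots,t_n\}$. The knowledge order $\le_k$ on $J_n$ has least element $\bot$, greatest element $\top$ and, in between, the two chains $f_n<_k\dots<_k f_0$ and $t_n<_k\dots<_k t_0$, with every $f_i$ incomparable to every $t_j$. The truth order $\le_t$ is given by $f_0<_t\dots<_t f_n<_t \top,\bot<_t t_n<_t\dots<_t t_0$, with $\top$ and $\bot$ incomparable. Let $\otimes,\oplus$ be the meet and join for $\le_k$, let $\wedge,\vee$ be the meet and join for $\le_t$, and let $\neg$ fix $\top,\bot$ and interchange $f_i$ and $t_i$ for each $i$. Let $\mathbf J_n=\langle J_n;\otimes,\oplus,\wedge,\vee,\neg,\top,f_0,\dots,f_n,t_0,\dots,t_n,\bot\rangle$, with every element named by a constant, and let $\mathcal V_n=\mathrm{HSP}(\mathbf J_n)$ be the variety generated by $\mathbf J_n$. Let $\mathbf J_{0,n}$ be the four-element algebra in the signature of $\mathbf J_n$ with the same $\otimes,\oplus,\wedge,\vee,\neg,\top,\bot$ as $\mathbf J_0$, in which all the constants $f_0,\dots,f_n$ take the value $f_0$ and all the constants $t_0,\dots,t_n$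 take the value $t_0$. For $1\le k\le n$ let $\mathbf J_{1,n,k}$ be the six-element algebra in the signature of $\mathbf J_n$ with the same $\otimes,\oplus,\wedge,\vee,\neg,\top,\bot$ as $\mathbf J_1$, in which the constants $f_i$ and $t_i$ take the values $f_0$ and $t_0$ for $i<k$, and the values $f_1$ and $t_1$ for $k\le i\le n$. An algebra is subdirectly irreducible if it is non-trivial and, whenever it is represented as a subdirect product, one of the coordinate projections is an isomorphism. An algebra $\mathbf E\in\mathcal V_n$ is injective in $\mathcal V_n$ if, for every embedding $g:\mathbf A\to\mathbf B$ between algebras of $\mathcal V_n$ and every homomorphism $h:\mathbf A\to\mathbf E$, there is a homomorphism $k:\mathbf B\to\mathbf E$ with $k\circ g=h$. (1) Up to isomorphism, the only subdirectly irreducible algebra in $\mathcal V_0$ is $\mathbf J_0$. (2) For $n\ge 1$, the variety $\mathcal V_n$ contains, up to isomorphism, exactly $n+1$ subdirectly irreducible algebras, namely the four-element algebra $\mathbf J_{0,n}$ and the six-element algebras $\mathbf J_{1,n,k}$ for $k\in\{1,\dots,n\}$, which are pairwise non-isomorphic. (3) For every $n\ge 0$, the algebras $\mathbf J_{0,n}$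 and $\mathbf J_{1,n,k}$, for $k\in\{1,\dots,n\}$, are injective in $\mathcal V_n$. (4) For every $n\ge 0$, every algebra in $\mathcal V_n$ embeds into an injective algebra in $\mathcal V_n$. (5) For every $n\ge 0$, the variety $\mathcal V_n$ has the congruence extension property (every congruence on a subalgebra of an algebra $\mathbf B\in\mathcal V_n$ is the restriction of a congruence on $\mathbf B$) and the amalgamation property (for all embeddings $f:\mathbf A\to\mathbf B$ and $g:\mathbf A\to\mathbf C$ in $\mathcal V_n$ there are $\mathbf D\in\mathcal V_n$ and embeddings $f':\mathbf B\to\mathbf D$, $g':\mathbf C\to\mathbf D$ with $f'\circ f=g'\circ g$). -/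

import Mathlib

open FirstOrder

universe u v

/-! ### Universal algebra

Algebras of a given signature are structures for a first-order language `L` without relation
symbols; homomorphisms, embeddings, isomorphisms and subalgebras are then Mathlib's
`A →[L] B`, `A ↪[L] B`, `A ≃[L] B` and `L.Substructure A`. -/

namespace UnivAlg

/-- The direct power `M ^ I`, with operations computed coordinatewise. -/
instance powerStructure (L : FirstOrder.Language.{0, 0}) [L.IsAlgebraic] (I : Type u) (M : Type v)
    [L.Structure M] : L.Structure (I → M) where
  funMap F x := fun i => FirstOrder.Language.Structure.funMap F (fun j => x j i)
  RelMap r _ := isEmptyElim r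

/-- `A` belongs to `HSP(M)`, the variety generated by `M`: it is a homomorphic image of a
subalgebra of a direct power of `M`. -/
def InHSP (L : FirstOrder.Language.{0, 0}) [L.IsAlgebraic] (M : Type) [L.Structure M]
    (A : Type u) [L.Structure A] : Prop :=
  ∃ (I : Type u) (S : L.Substructure (I → M)) (f : S →[L] A), Function.Surjective f

/-- `A` is subdirectly irreducible: it is non-trivial, and whenever `A` is represented as a
subdirect product of a family `B i` (the coordinate maps `f i` are onto and jointly
injective), one of the coordinate maps is an isomorphism. -/
def SubdirectlyIrreducible (L : FirstOrder.Language.{0, 0}) [L.IsAlgebraic] (A : Type u)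
    [L.Structure A] : Prop :=
  Nontrivial A ∧
    ∀ (I : Type u) (B : I → Type u) [∀ i, L.Structure (B i)] (f : ∀ i, A →[L] B i),
      (∀ i, Function.Surjective (f i)) →
      (∀ a b : A, (∀ i, f i a = f i b) → a = b) →
      ∃ i, Function.Bijective (f i)

/-- `E` is an injective member of the variety `HSP(M)`: every homomorphism `h : A → E`
extends along every embedding `g : A → B`, for `A` and `B` in the variety. -/
def IsInjectiveInHSP (L : FirstOrder.Language.{0, 0}) [L.IsAlgebraic] (M : Type) [L.Structure M]
    (E : Type v) [L.Structure E] : Prop :=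
  InHSP L M E ∧
    ∀ (A B : Type u) [L.Structure A] [L.Structure B], InHSP L M A → InHSP L M B →
      ∀ (g : A ↪[L] B) (h : A →[L] E), ∃ k : B →[L] E, ∀ a : A, k (g a) = h a

/-- An equivalence relation that is compatible with all the operations. -/
def IsCongruence (L : FirstOrder.Language.{0, 0}) {A : Type u} [L.Structure A] (θ : Setoid A) : Prop :=
  ∀ (m : ℕ) (F : L.Functions m) (x y : Fin m → A),
    (∀ j, θ (x j) (y j)) → θ (FirstOrder.Language.Structure.funMap F x) (FirstOrder.Language.Structure.funMap F y)

/-- The variety `HSP(M)` has the congruence extension property: every congruence on a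
subalgebra `S` of a member `B` is the restriction to `S` of a congruence on `B`. -/
def HasCEP (L : FirstOrder.Language.{0, 0}) [L.IsAlgebraic] (M : Type) [L.Structure M] : Prop :=
  ∀ (B : Type u) [L.Structure B], InHSP L M B →
    ∀ (S : L.Substructure B) (θ : Setoid S), IsCongruence L θ →
      ∃ Θ : Setoid B, IsCongruence L Θ ∧ ∀ a b : S, θ a b ↔ Θ (a : B) (b : B)

/-- The variety `HSP(M)` has the amalgamation property. -/
def HasAP (L : FirstOrder.Language.{0, 0}) [L.IsAlgebraic] (M : Type) [L.Structure M] : Prop :=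
  ∀ (A B C : Type u) [L.Structure A] [L.Structure B] [L.Structure C],
    InHSP L M A → InHSP L M B → InHSP L M C →
      ∀ (f : A ↪[L] B) (g : A ↪[L] C),
        ∃ (D : Type u) (_ : L.Structure D) (f' : B ↪[L] D) (g' : C ↪[L] D),
          InHSP L M D ∧ ∀ a : A, f' (f a) = g' (g a)

end UnivAlg

/-! ### The prioritised default bilattices -/

namespace DefaultBilattice

/-- The set `J_n = {⊤, f_0, …, f_n, t_0, …, t_n, ⊥}`. -/
inductive JSet (n : ℕ) : Type
  | top : JSet n
  | bot : JSet n
  | f (i : Fin (n + 1)) : JSet n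
  | t (i : Fin (n + 1)) : JSet n
  deriving DecidableEq

namespace JSet

variable {n : ℕ}

/-- Knowledge order: `⊥` is least, `⊤` is greatest, and in between there are the two
unrelated chains `f_n < ⋯ < f_0` and `t_n < ⋯ < t_0`. -/
def leK : JSet n → JSet n → Prop
  | bot, _ => True
  | _, top => True
  | f i, f j => j ≤ i
  | t i, t j => j ≤ i
  | _, _ => False

/-- Truth order: `f_0 < ⋯ < f_n < ⊤, ⊥ < t_n < ⋯ < t_0`, where `⊤` and `⊥` are
incomparable. -/
def leT : JSet n → JSet n → Prop
  | f i, f j => i ≤ j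
  | f _, _ => True
  | t i, t j => j ≤ i
  | _, t _ => True
  | top, top => True
  | bot, bot => True
  | _, _ => False

/-- `⊗`, the meet in the knowledge order. -/
def meetK : JSet n → JSet n → JSet n
  | top, y => y
  | x, top => x
  | f i, f j => f (max i j)
  | t i, t j => t (max i j)
  | _, _ => bot

/-- `⊕`, the join in the knowledge order. -/
def joinK : JSet n → JSet n → JSet n
  | bot, y => y
  | x, bot => x
  | f i, f j => f (min i j)
  | t i, t j => t (min i j)
  | _, _ => top

/-- `∧`, the meet in the truth order. -/
def meetT : JSet n → JSet n → JSet n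
  | f i, f j => f (min i j)
  | f i, _ => f i
  | _, f j => f j
  | t i, t j => t (max i j)
  | t _, y => y
  | x, t _ => x
  | top, top => top
  | bot, bot => bot
  | _, _ => f (Fin.last n)

/-- `∨`, the join in the truth order. -/
def joinT : JSet n → JSet n → JSet n
  | t i, t j => t (min i j)
  | t i, _ => t i
  | _, t j => t j
  | f i, f j => f (max i j)
  | f _, y => y
  | x, f _ => x
  | top, top => top
  | bot, bot => bot
  | _, _ => t (Fin.last n)

/-- The negation. -/
def neg : JSet n → JSet n
  | top => top
  | bot => bot
  | f i => t i
  | t i => f i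

theorem leK_refl (x : JSet n) : leK x x := by cases x <;> simp [leK]

theorem leK_antisymm (x y : JSet n) : leK x y → leK y x → x = y := by
  cases x <;> cases y <;> simp [leK] <;> intro h h' <;> exact le_antisymm h' h

theorem leK_trans (x y z : JSet n) : leK x y → leK y z → leK x z := by
  cases x <;> cases y <;> cases z <;> simp [leK] <;> intro h h' <;> exact le_trans h' h

theorem leT_refl (x : JSet n) : leT x x := by cases x <;> simp [leT]

theorem leT_antisymm (x y : JSet n) : leT x y → leT y x → x = y := by
  cases x <;> cases y <;> simp [leT] <;> intro h h' <;>
    first | exact le_antisymm h h' | exact le_antisymm h' h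

theorem leT_trans (x y z : JSet n) : leT x y → leT y z → leT x z := by
  cases x <;> cases y <;> cases z <;> simp [leT] <;> intro h h' <;>
    first | exact le_trans h h' | exact le_trans h' h

/-- `meetK` is the greatest lower bound for `leK`. -/
theorem leK_meetK_iff (x y z : JSet n) : leK z (meetK x y) ↔ leK z x ∧ leK z y := by
  cases x <;> cases y <;> cases z <;> simp [leK, meetK]

/-- `joinK` is the least upper bound for `leK`. -/
theorem joinK_leK_iff (x y z : JSet n) : leK (joinK x y) z ↔ leK x z ∧ leK y z := by
  cases x <;> cases y <;> cases z <;> simp [leK, joinK]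

/-- `meetT` is the greatest lower bound for `leT`. -/
theorem leT_meetT_iff (x y z : JSet n) : leT z (meetT x y) ↔ leT z x ∧ leT z y := by
  cases x <;> cases y <;> cases z <;> simp [leT, meetT, Fin.le_last]

/-- `joinT` is the least upper bound for `leT`. -/
theorem joinT_leT_iff (x y z : JSet n) : leT (joinT x y) z ↔ leT x z ∧ leT y z := by
  cases x <;> cases y <;> cases z <;> simp [leT, joinT, Fin.le_last]

/-- The map `J_n → J_m` that fixes `⊤` and `⊥` and sends `f_i` to `f_{φ(i)}` and `t_i` to
`t_{φ(i)}`. -/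
def relabel {m : ℕ} (φ : Fin (n + 1) → Fin (m + 1)) : JSet n → JSet m
  | top => top
  | bot => bot
  | f i => f (φ i)
  | t i => t (φ i)

end JSet

/-- The operation symbols of `J_n`, sorted by arity: `⊗, ⊕, ∧, ∨, ¬`, and one constant symbol
for each element of `J_n`. -/
inductive Ops (n : ℕ) : ℕ → Type
  | otimes : Ops n 2
  | oplus : Ops n 2
  | wedge : Ops n 2
  | vee : Ops n 2
  | neg : Ops n 1
  | const (c : JSet n) : Ops n 0

/-- The signature of `J_n`. -/
def sig (n : ℕ) : FirstOrder.Language.{0, 0} := ⟨Ops n, fun _ => Empty⟩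

instance (n : ℕ) : (sig n).IsAlgebraic := fun _ => inferInstanceAs (IsEmpty Empty)

/-- The algebra in the signature of `J_n` that has the bilattice reduct of `J_m`, and in
which the constants `⊤`, `⊥`, `f_i`, `t_i` take the values `⊤`, `⊥`, `f_{φ(i)}`,
`t_{φ(i)}`. -/
@[reducible] def interp (n m : ℕ) (φ : Fin (n + 1) → Fin (m + 1)) : (sig n).Structure (JSet m) where
  funMap {_} F := match F with
    | Ops.otimes => fun x => JSet.meetK (x 0) (x 1)
    | Ops.oplus => fun x => JSet.joinK (x 0) (x 1)
    | Ops.wedge => fun x => JSet.meetT (x 0) (x 1)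
    | Ops.vee => fun x => JSet.joinT (x 0) (x 1)
    | Ops.neg => fun x => JSet.neg (x 0)
    | Ops.const c => fun _ => JSet.relabel φ c
  RelMap r _ := isEmptyElim r

/-- The prioritised default bilattice `J_n`. -/
def J (n : ℕ) : Type := JSet n

instance (n : ℕ) : (sig n).Structure (J n) := interp n n id

/-- The algebra `J_{0,n}`: its bilattice reduct is that of `J_0`, all the constants `f_i` take
the value `f_0` and all the constants `t_i` take the value `t_0`. -/
def J0 (_n : ℕ) : Type := JSet 0

instance (n : ℕ) : (sig n).Structure (J0 n) := interp n 0 (fun _ => 0)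

/-- The algebra `J_{1,n,k}` (for `1 ≤ k ≤ n`): its bilattice reduct is that of `J_1`; the
constants `f_i`, `t_i` take the values `f_0`, `t_0` for `i < k`, and the values `f_1`, `t_1`
for `k ≤ i`. -/
def J1 (_n _k : ℕ) : Type := JSet 1

instance (n k : ℕ) : (sig n).Structure (J1 n k) :=
  interp n 1 (fun i => if (i : ℕ) < k then 0 else 1)

/-- Membership in the variety `V_n = HSP(J_n)`. -/
def InV (n : ℕ) (A : Type u) [(sig n).Structure A] : Prop := UnivAlg.InHSP (sig n) (J n) A

/-- `E` is an injective algebra in `V_n` (tested against the algebras of `V_n` in `Type u`). -/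
def IsInjectiveInV (n : ℕ) (E : Type v) [(sig n).Structure E] : Prop :=
  UnivAlg.IsInjectiveInHSP.{u, v} (sig n) (J n) E

end DefaultBilattice

open UnivAlg DefaultBilattice

/-! The truth lattice supplies a majority term, so congruence lattices in the variety are
distributive and Jónsson's lemma applies. Two further facts make it decisive: `J n` is finite, and
all its elements are constants. Hence every member of the variety receives a unique homomorphism `κ`
from `J n`, and an element of a subalgebra of a power agrees with some constant tuple on a set of
the ultrafilter. A completely meet-irreducible congruence is therefore controlled by its pullback
along `κ`.

On `J n` itself, a congruence either collapses everything or is given by a partition of the indices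
`0, …, n` into intervals. It is thus an intersection of kernels of maps that forget the indices
(giving `J0 n`) or cut them in two (giving `J1 n k`). Together these yield `InV.exists_hom_ne`:
homomorphisms into the family `Fam` separate the classes of any congruence.

For `exists_extension`, the kernel of `h : A → Fam n x` is meet-irreducible because `Fam n x` has a
monolith. Jónsson's lemma, applied to the restrictions to `A` of all homomorphisms from `B` to the
family, gives an ultrafilter, and the limit of those homomorphisms along it extends `h`. The
remaining claims follow from separation and extension, using products of members of the family. -/

open UnivAlg DefaultBilattice

open Filter

namespace UnivAlg

/-! ### Congruences, majority operations and Jónsson's lemma. -/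

section Congruences

variable {L : FirstOrder.Language.{0, 0}} {A : Type*} [L.Structure A]

/-- An equivalence relation preserved by every unary translation is a congruence. -/
theorem isCongruence_of_update (θ : Setoid A)
    (h : ∀ (m : ℕ) (F : L.Functions m) (x : Fin m → A) (j : Fin m) (a b : A), θ a b →
      θ (Language.Structure.funMap F (Function.update x j a))
        (Language.Structure.funMap F (Function.update x j b))) :
    IsCongruence L θ := by
  classical
  intro m F x y hxy
  -- The coordinates of `x` are exchanged for those of `y` one at a time.
  have key : ∀ s : Finset (Fin m),
      θ (Language.Structure.funMap F x) (Language.Structure.funMap F (s.piecewise y x)) := by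
    intro s
    induction s using Finset.induction_on with
    | empty => simp
    | insert j s hj ih =>
      refine θ.trans ih ?_
      have := h m F (s.piecewise y x) j (x j) (y j) (hxy j)
      rw [Finset.piecewise_insert]
      convert this using 2
      rw [← Finset.piecewise_eq_of_notMem s y x hj, Function.update_eq_self]
  simpa using key Finset.univ

theorem IsCongruence.update {θ : Setoid A} (h : IsCongruence L θ) {m : ℕ} (F : L.Functions m)
    (x : Fin m → A) (j : Fin m) {a b : A} (hab : θ a b) :
    θ (Language.Structure.funMap F (Function.update x j a))
      (Language.Structure.funMap F (Function.update x j b)) := by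
  classical
  apply h
  intro i
  by_cases hi : i = j
  · subst hi
    simpa using hab
  · simp [hi]

/-- A unary translation pulls `α ⊔ β` back to an equivalence relation above both `α` and `β`, hence
above their join; no zigzag chains are needed. -/
theorem IsCongruence.sup {α β : Setoid A} (hα : IsCongruence L α) (hβ : IsCongruence L β) :
    IsCongruence L (α ⊔ β) := by
  apply isCongruence_of_update
  intro m F x j a b hab
  have : α ⊔ β ≤ Setoid.comap
      (fun a => Language.Structure.funMap F (Function.update x j a)) (α ⊔ β) := by
    refine sup_le ?_ ?_
    · intro a b h
      exact (le_sup_left : α ≤ α ⊔ β) (hα.update F x j h)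
    · intro a b h
      exact (le_sup_right : β ≤ α ⊔ β) (hβ.update F x j h)
  exact this hab

theorem IsCongruence.comap {B : Type*} [L.Structure B] {θ : Setoid B} (h : IsCongruence L θ)
    (f : A →[L] B) : IsCongruence L (Setoid.comap f θ) := by
  intro m F x y hxy
  rw [Setoid.comap_rel, f.map_fun, f.map_fun]
  exact h m F _ _ hxy

theorem isCongruence_ker {B : Type*} [L.Structure B] (f : A →[L] B) :
    IsCongruence L (Setoid.ker f) := by
  intro m F x y hxy
  rw [Setoid.ker_def, f.map_fun, f.map_fun]
  congr 1
  funext j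
  exact hxy j

/-- The intersection of the members of a family of equivalence relations indexed by `J`. -/
def interOn {I : Type*} (θ : I → Setoid A) (J : Set I) : Setoid A where
  r a b := ∀ i ∈ J, θ i a b
  iseqv := ⟨fun _ i _ => (θ i).refl _, fun h i hi => (θ i).symm (h i hi),
    fun h h' i hi => (θ i).trans (h i hi) (h' i hi)⟩

theorem isCongruence_interOn {I : Type*} {θ : I → Setoid A} (h : ∀ i, IsCongruence L (θ i))
    (J : Set I) : IsCongruence L (interOn θ J) :=
  fun m F _ _ hxy i hi => h i m F _ _ fun j => hxy j i hi

/-- A majority operation that is preserved by all congruences. -/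
structure IsMajority (L : FirstOrder.Language.{0, 0}) {A : Type*} [L.Structure A]
    (m : A → A → A → A) : Prop where
  left (x y : A) : m x x y = x
  mid (x y : A) : m x y x = x
  right (x y : A) : m x y y = y
  congr (θ : Setoid A) (h : IsCongruence L θ) (x x' y y' z z' : A) (hx : θ x x') (hy : θ y y')
    (hz : θ z z') : θ (m x y z) (m x' y' z')

variable {m : A → A → A → A}

/-- The map `z ↦ m p q z` fixes both `p` and `q`, and when `θ p q` holds all its values are
`θ`-related to `p`. It therefore turns `α`-steps and `β`-steps from `p` to `q` into steps of `θ ⊓ α`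
and `θ ⊓ β`. -/
theorem IsMajority.inf_sup_le (hm : IsMajority L m) {θ α β : Setoid A} (hθ : IsCongruence L θ)
    (hα : IsCongruence L α) (hβ : IsCongruence L β) : θ ⊓ (α ⊔ β) ≤ (θ ⊓ α) ⊔ (θ ⊓ β) := by
  intro p q hpq
  have hθpq : θ p q := hpq.1
  have hp (z z' : A) : θ (m p q z) (m p q z') := by
    have h1 (z) : θ (m p q z) p := by
      have := hm.congr θ hθ p p q p z z (θ.refl _) (θ.symm hθpq) (θ.refl _)
      rwa [hm.left] at this
    exact θ.trans (h1 z) (θ.symm (h1 z'))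
  have : α ⊔ β ≤ Setoid.comap (m p q) ((θ ⊓ α) ⊔ (θ ⊓ β)) := by
    refine sup_le ?_ ?_
    · intro z z' h
      exact (le_sup_left : θ ⊓ α ≤ (θ ⊓ α) ⊔ (θ ⊓ β))
        ⟨hp z z', hm.congr α hα _ _ _ _ _ _ (α.refl _) (α.refl _) h⟩
    · intro z z' h
      exact (le_sup_right : θ ⊓ β ≤ (θ ⊓ α) ⊔ (θ ⊓ β))
        ⟨hp z z', hm.congr β hβ _ _ _ _ _ _ (β.refl _) (β.refl _) h⟩
  have h := this hpq.2
  rwa [Setoid.comap_rel, hm.mid, hm.right] at h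

theorem IsMajority.sup_inf_sup_le (hm : IsMajority L m) {ψ α β : Setoid A}
    (hψ : IsCongruence L ψ) (hα : IsCongruence L α) (hβ : IsCongruence L β) :
    (ψ ⊔ α) ⊓ (ψ ⊔ β) ≤ ψ ⊔ (α ⊓ β) := by
  refine (hm.inf_sup_le (hψ.sup hα) hψ hβ).trans (sup_le (inf_le_right.trans le_sup_left) ?_)
  rw [inf_comm]
  refine (hm.inf_sup_le hβ hψ hα).trans (sup_le (inf_le_right.trans le_sup_left) ?_)
  rw [inf_comm]
  exact le_sup_right

/-- Jónsson's lemma: in an algebra with a majority operation, a meet-irreducible congruence `ψ`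
that contains the intersection of a family of congruences contains the congruence induced by
an ultrafilter on the index set. -/
theorem IsMajority.exists_ultrafilter (hm : IsMajority L m) {I : Type*} {θ : I → Setoid A}
    (hθ : ∀ i, IsCongruence L (θ i)) {ψ : Setoid A} (hψ : IsCongruence L ψ)
    (hirr : ∀ α β : Setoid A, IsCongruence L α → IsCongruence L β → ψ ≤ α → ψ ≤ β →
      α ⊓ β ≤ ψ → α ≤ ψ ∨ β ≤ ψ)
    (hne : ∃ a b, ¬ ψ a b) (hle : ∀ a b, (∀ i, θ i a b) → ψ a b) :
    ∃ U : Ultrafilter I, ∀ a b, (∀ᶠ i in (U : Filter I), θ i a b) → ψ a b := by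
  obtain ⟨a₀, b₀, h₀⟩ := hne
  -- A set is large when the congruences indexed by its complement do not suffice to force `ψ`.
  -- Closure under intersection is where distributivity and irreducibility of `ψ` enter.
  let F : Filter I :=
    { sets := {J | ¬ interOn θ Jᶜ ≤ ψ}
      univ_sets := fun h => h₀ (h fun i hi => absurd trivial hi)
      sets_of_superset := by
        intro J K hJ hJK hK
        exact hJ fun a b hab => hK fun i hi => hab i fun hiJ => hi (hJK hiJ)
      inter_sets := by
        intro J K hJ hK h
        have hle' : (ψ ⊔ interOn θ Jᶜ) ⊓ (ψ ⊔ interOn θ Kᶜ) ≤ ψ := by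
          refine (hm.sup_inf_sup_le hψ (isCongruence_interOn hθ _)
            (isCongruence_interOn hθ _)).trans (sup_le le_rfl ?_)
          intro a b hab
          refine h fun i hi => ?_
          rw [Set.compl_inter] at hi
          exact hi.elim (hab.1 i) (hab.2 i)
        rcases hirr _ _ (hψ.sup (isCongruence_interOn hθ _))
          (hψ.sup (isCongruence_interOn hθ _)) le_sup_left le_sup_left hle' with h' | h'
        · exact hJ (le_sup_right.trans h')
        · exact hK (le_sup_right.trans h') }
  have hF : F.NeBot := by
    refine ⟨fun hbot => ?_⟩
    have : (∅ : Set I) ∈ F := by rw [hbot]; trivial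
    exact this fun a b hab => hle a b fun i => hab i (by simp)
  refine ⟨Ultrafilter.of F, fun a b hab => ?_⟩
  by_contra hn
  -- The pair `(a, b)` itself witnesses that this complement is large.
  have hmem : {i | θ i a b}ᶜ ∈ F := by
    intro h
    exact hn (h fun i hi => by simpa using hi)
  have h1 : {i | θ i a b}ᶜ ∈ Ultrafilter.of F := Ultrafilter.of_le F hmem
  exact (Ultrafilter.compl_mem_iff_notMem.mp h1) hab

/-- A congruence that does not relate `a` and `b` is contained in a maximal one. -/
theorem IsCongruence.exists_maximal {θ : Setoid A} (hθ : IsCongruence L θ) {a b : A}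
    (hab : ¬ θ a b) :
    ∃ ψ : Setoid A, IsCongruence L ψ ∧ θ ≤ ψ ∧ ¬ ψ a b ∧
      ∀ α : Setoid A, IsCongruence L α → ψ ≤ α → ¬ α a b → α ≤ ψ := by
  obtain ⟨ψ, hle, hmax⟩ := zorn_le_nonempty₀ {ψ : Setoid A | IsCongruence L ψ ∧ ¬ ψ a b} (by
    intro c hc hchain y hy
    let σ : Setoid A :=
      { r := fun x z => ∃ ψ ∈ c, ψ x z
        iseqv := by
          refine ⟨fun x => ⟨y, hy, y.refl _⟩, fun ⟨ψ, h, h'⟩ => ⟨ψ, h, ψ.symm h'⟩, ?_⟩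
          rintro p q r ⟨ψ, h, h'⟩ ⟨φ, k, k'⟩
          rcases hchain.total h k with hle | hle
          · exact ⟨φ, k, φ.trans (hle h') k'⟩
          · exact ⟨ψ, h, ψ.trans h' (hle k')⟩ }
    refine ⟨σ, ⟨isCongruence_of_update _ ?_, ?_⟩, fun ψ hψ p q h => ⟨ψ, hψ, h⟩⟩
    · rintro m F x j p q ⟨ψ, h, h'⟩
      exact ⟨ψ, h, (hc h).1.update F x j h'⟩
    · rintro ⟨ψ, h, h'⟩
      exact (hc h).2 h') θ ⟨hθ, hab⟩
  exact ⟨ψ, hmax.prop.1, hle, hmax.prop.2, fun α hα h1 h2 => hmax.le_of_ge ⟨hα, h2⟩ h1⟩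

end Congruences

/-! ### Factoring homomorphisms, and limits along ultrafilters. -/

section Homs

variable {L : FirstOrder.Language.{0, 0}} [L.IsAlgebraic]

/-- A map that commutes with the operations, as a homomorphism. -/
def homOfMapFun {A B : Type*} [L.Structure A] [L.Structure B] (f : A → B)
    (hf : ∀ (m : ℕ) (F : L.Functions m) (x : Fin m → A),
      f (Language.Structure.funMap F x) = Language.Structure.funMap F (f ∘ x)) : A →[L] B where
  toFun := f
  map_fun' F x := hf _ F x
  map_rel' r _ _ := isEmptyElim r

@[simp]
theorem homOfMapFun_apply {A B : Type*} [L.Structure A] [L.Structure B] (f : A → B)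
    (hf : ∀ (m : ℕ) (F : L.Functions m) (x : Fin m → A),
      f (Language.Structure.funMap F x) = Language.Structure.funMap F (f ∘ x)) (a : A) :
    homOfMapFun f hf a = f a := rfl

/-- Homomorphisms factor through surjective homomorphisms with a smaller kernel. -/
theorem exists_factor {A B E : Type*} [L.Structure A] [L.Structure B] [L.Structure E]
    (f : A →[L] B) (hf : Function.Surjective f) (h : A →[L] E)
    (hker : ∀ a a', f a = f a' → h a = h a') : ∃ k : B →[L] E, ∀ a, k (f a) = h a := by
  choose s hs using hf
  refine ⟨homOfMapFun (fun b => h (s b)) ?_, fun a => hker _ _ (hs _)⟩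
  intro m F x
  rw [← show Language.Structure.funMap F (h ∘ (s ∘ x)) =
    Language.Structure.funMap F ((fun b => h (s b)) ∘ x) from rfl, ← h.map_fun]
  apply hker
  rw [hs, f.map_fun]
  congr 1
  funext j
  exact (hs _).symm

/-- The limit along an ultrafilter of a family of homomorphisms into quotients of a finite
algebra. -/
theorem exists_limit_hom {M B E I : Type*} [Finite M] [L.Structure M] [L.Structure B]
    [L.Structure E] {N : I → Type*} [∀ i, L.Structure (N i)] (U : Ultrafilter I)
    (y : ∀ i, M →[L] N i) (hy : ∀ i, Function.Surjective (y i)) (x : ∀ i, B →[L] N i)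
    (r : M →[L] E) (hr : ∀ c c', (∀ᶠ i in (U : Filter I), y i c = y i c') → r c = r c') :
    ∃ k : B →[L] E, (∀ b c, (∀ᶠ i in (U : Filter I), x i b = y i c) → k b = r c) ∧
      ∀ b, ∃ c, ∀ᶠ i in (U : Filter I), x i b = y i c := by
  have hex : ∀ b, ∃ c, ∀ᶠ i in (U : Filter I), x i b = y i c := by
    intro b
    choose d hd using fun i => hy i (x i b)
    -- An ultrafilter on the finite set `M` is principal, so one `c` lifts almost all the values `x
    -- i b`.
    obtain ⟨c, hc⟩ := (U.map d).eq_pure_of_finite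
    refine ⟨c, ?_⟩
    have h1 : {c} ∈ U.map d := by rw [hc]; exact rfl
    have h2 : ∀ᶠ i in (U : Filter I), d i = c := h1
    filter_upwards [h2] with i hi
    rw [← hi, hd]
  choose l hl using hex
  have hk : ∀ b c, (∀ᶠ i in (U : Filter I), x i b = y i c) → r (l b) = r c := by
    intro b c h
    apply hr
    filter_upwards [h, hl b] with i h1 h2
    rw [← h1, h2]
  refine ⟨homOfMapFun (fun b => r (l b)) ?_, hk, fun b => ⟨l b, hl b⟩⟩
  intro m F z
  rw [← show Language.Structure.funMap F (r ∘ (l ∘ z)) =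
    Language.Structure.funMap F ((fun b => r (l b)) ∘ z) from rfl, ← r.map_fun]
  apply hk
  have : ∀ᶠ i in (U : Filter I), ∀ j, x i (z j) = y i (l (z j)) :=
    eventually_all.mpr fun j => hl (z j)
  filter_upwards [this] with i hi
  rw [(x i).map_fun, (y i).map_fun]
  congr 1
  funext j
  exact hi j

end Homs

end UnivAlg

namespace DefaultBilattice

/-! ### Congruences of `J n`. -/

section Congruences

variable {n : ℕ} {ψ : Setoid (J n)}

theorem rel_meetK (h : IsCongruence (sig n) ψ) {a a' b b' : JSet n} (h₁ : ψ a a') (h₂ : ψ b b') :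
    ψ (JSet.meetK a b) (JSet.meetK a' b') :=
  h 2 Ops.otimes ![a, b] ![a', b'] (by intro j; fin_cases j <;> assumption)

theorem rel_joinK (h : IsCongruence (sig n) ψ) {a a' b b' : JSet n} (h₁ : ψ a a') (h₂ : ψ b b') :
    ψ (JSet.joinK a b) (JSet.joinK a' b') :=
  h 2 Ops.oplus ![a, b] ![a', b'] (by intro j; fin_cases j <;> assumption)

theorem rel_neg (h : IsCongruence (sig n) ψ) {a a' : JSet n} (h₁ : ψ a a') :
    ψ (JSet.neg a) (JSet.neg a') :=
  h 1 Ops.neg ![a] ![a'] (by intro j; fin_cases j; assumption)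

theorem rel_of_top_bot (h : IsCongruence (sig n) ψ) (h₁ : ψ JSet.top JSet.bot) (a b : JSet n) :
    ψ a b := by
  have key : ∀ a : JSet n, ψ a JSet.bot := by
    intro a
    have := rel_meetK h h₁ (ψ.refl a)
    cases a <;> exact this
  exact ψ.trans (key a) (ψ.symm (key b))

/-- Negation also gives `t_i ~ ⊥`, and `f_i ⊕ t_i = ⊤`. The next lemma is dual, with `f_i ⊗ t_i =
⊥`. -/
theorem top_bot_of_f_bot (h : IsCongruence (sig n) ψ) {i : Fin (n + 1)}
    (h₁ : ψ (JSet.f i) JSet.bot) : ψ JSet.top JSet.bot :=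
  rel_joinK h h₁ (rel_neg h h₁)

theorem top_bot_of_f_top (h : IsCongruence (sig n) ψ) {i : Fin (n + 1)}
    (h₁ : ψ (JSet.f i) JSet.top) : ψ JSet.top JSet.bot :=
  ψ.symm (rel_meetK h h₁ (rel_neg h h₁))

theorem top_bot_of_f_t (h : IsCongruence (sig n) ψ) {i j : Fin (n + 1)}
    (h₁ : ψ (JSet.f i) (JSet.t j)) : ψ JSet.top JSet.bot := by
  apply top_bot_of_f_bot h (i := i)
  have := rel_meetK h h₁ (ψ.refl (JSet.f i))
  simpa [JSet.meetK] using this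

/-- A congruence that does not collapse `⊤` and `⊥` only relates false elements to false
elements and true elements to true elements. -/
theorem rel_cases (h : IsCongruence (sig n) ψ) {a b : JSet n} (hab : ψ a b) :
    a = b ∨ ψ JSet.top JSet.bot ∨ (∃ i j, a = JSet.f i ∧ b = JSet.f j) ∨
      ∃ i j, a = JSet.t i ∧ b = JSet.t j := by
  cases a with
  | top =>
    cases b with
    | top => exact Or.inl rfl
    | bot => exact Or.inr (Or.inl hab)
    | f j => exact Or.inr (Or.inl (top_bot_of_f_top h (ψ.symm hab)))
    | t j => exact Or.inr (Or.inl (top_bot_of_f_top h (ψ.symm (rel_neg h hab))))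
  | bot =>
    cases b with
    | top => exact Or.inr (Or.inl (ψ.symm hab))
    | bot => exact Or.inl rfl
    | f j => exact Or.inr (Or.inl (top_bot_of_f_bot h (ψ.symm hab)))
    | t j => exact Or.inr (Or.inl (top_bot_of_f_bot h (ψ.symm (rel_neg h hab))))
  | f i =>
    cases b with
    | top => exact Or.inr (Or.inl (top_bot_of_f_top h hab))
    | bot => exact Or.inr (Or.inl (top_bot_of_f_bot h hab))
    | f j => exact Or.inr (Or.inr (Or.inl ⟨i, j, rfl, rfl⟩))
    | t j => exact Or.inr (Or.inl (top_bot_of_f_t h hab))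
  | t i =>
    cases b with
    | top => exact Or.inr (Or.inl (top_bot_of_f_top h (rel_neg h hab)))
    | bot => exact Or.inr (Or.inl (top_bot_of_f_bot h (rel_neg h hab)))
    | f j => exact Or.inr (Or.inl (top_bot_of_f_t h (ψ.symm hab)))
    | t j => exact Or.inr (Or.inr (Or.inr ⟨i, j, rfl, rfl⟩))

theorem rel_f_of_rel_t (h : IsCongruence (sig n) ψ) {i j : Fin (n + 1)}
    (h₁ : ψ (JSet.t i) (JSet.t j)) : ψ (JSet.f i) (JSet.f j) :=
  rel_neg h h₁

theorem rel_t_of_rel_f (h : IsCongruence (sig n) ψ) {i j : Fin (n + 1)}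
    (h₁ : ψ (JSet.f i) (JSet.f j)) : ψ (JSet.t i) (JSet.t j) :=
  rel_neg h h₁

/-- The classes of a congruence on the chain of the false elements are convex. -/
theorem rel_f_convex (h : IsCongruence (sig n) ψ) {i j p q : Fin (n + 1)}
    (h₁ : ψ (JSet.f i) (JSet.f j)) (hip : i ≤ p) (hpq : p ≤ q) (hqj : q ≤ j) :
    ψ (JSet.f p) (JSet.f q) := by
  -- Knowledge order reverses indices: `⊗ f_p` carries the pair to `(f_p, f_j)`, and `⊕ f_q` then
  -- carries it to `(f_p, f_q)`.
  have h₂ := rel_meetK h h₁ (ψ.refl (JSet.f p))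
  have h₃ := rel_joinK h h₂ (ψ.refl (JSet.f q))
  simpa [JSet.meetK, JSet.joinK, max_eq_right hip, max_eq_left (hpq.trans hqj),
    min_eq_left hpq, min_eq_right hqj] using h₃

end Congruences

/-! ### The family of quotients of `J n` and its monoliths. -/

/-- The algebras `J_{0,n}` and `J_{1,n,k}`, for `1 ≤ k ≤ n`, as one family. -/
def Fam (n : ℕ) : Option (Fin n) → Type
  | none => J0 n
  | some k => J1 n (k + 1)

instance (n : ℕ) : ∀ x, (sig n).Structure (Fam n x)
  | none => inferInstanceAs ((sig n).Structure (J0 n))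
  | some k => inferInstanceAs ((sig n).Structure (J1 n (k + 1)))

/-- Monotonicity handles the chains; `hlast` is needed because `⊤ ∧ ⊥ = f_n` and `⊤ ∨ ⊥ = t_n`. -/
theorem relabel_funMap {n m : ℕ} {φ : Fin (n + 1) → Fin (m + 1)} (hφ : Monotone φ)
    (hlast : φ (Fin.last n) = Fin.last m) (l : ℕ) (F : Ops n l) (x : Fin l → JSet n) :
    JSet.relabel φ ((interp n n id).funMap F x) =
      (interp n m φ).funMap F (JSet.relabel φ ∘ x) := by
  cases F with
  | otimes =>
    change JSet.relabel φ (JSet.meetK (x 0) (x 1)) =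
      JSet.meetK (JSet.relabel φ (x 0)) (JSet.relabel φ (x 1))
    cases x 0 <;> cases x 1 <;> simp [JSet.meetK, JSet.relabel, hφ.map_max]
  | oplus =>
    change JSet.relabel φ (JSet.joinK (x 0) (x 1)) =
      JSet.joinK (JSet.relabel φ (x 0)) (JSet.relabel φ (x 1))
    cases x 0 <;> cases x 1 <;> simp [JSet.joinK, JSet.relabel, hφ.map_min]
  | wedge =>
    change JSet.relabel φ (JSet.meetT (x 0) (x 1)) =
      JSet.meetT (JSet.relabel φ (x 0)) (JSet.relabel φ (x 1))
    cases x 0 <;> cases x 1 <;> simp [JSet.meetT, JSet.relabel, hφ.map_max, hφ.map_min, hlast]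
  | vee =>
    change JSet.relabel φ (JSet.joinT (x 0) (x 1)) =
      JSet.joinT (JSet.relabel φ (x 0)) (JSet.relabel φ (x 1))
    cases x 0 <;> cases x 1 <;> simp [JSet.joinT, JSet.relabel, hφ.map_max, hφ.map_min, hlast]
  | neg =>
    change JSet.relabel φ (JSet.neg (x 0)) = JSet.neg (JSet.relabel φ (x 0))
    cases x 0 <;> rfl
  | const c =>
    change JSet.relabel φ (JSet.relabel id c) = JSet.relabel φ c
    cases c <;> rfl

theorem relabel_surjective {n m : ℕ} {φ : Fin (n + 1) → Fin (m + 1)}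
    (hφ : Function.Surjective φ) : Function.Surjective (JSet.relabel φ) := by
  rintro (_ | _ | i | i)
  · exact ⟨JSet.top, rfl⟩
  · exact ⟨JSet.bot, rfl⟩
  · obtain ⟨j, rfl⟩ := hφ i
    exact ⟨JSet.f j, rfl⟩
  · obtain ⟨j, rfl⟩ := hφ i
    exact ⟨JSet.t j, rfl⟩

/-- The map on indices that defines `J_{1,n,k}`. -/
def cut (n k : ℕ) (i : Fin (n + 1)) : Fin (1 + 1) := if (i : ℕ) < k then 0 else 1

theorem cut_monotone (n k : ℕ) : Monotone (cut n k) := by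
  intro i j hij
  have : (i : ℕ) ≤ j := hij
  unfold cut
  split_ifs <;> first | omega | simp

theorem cut_last {n k : ℕ} (hk : k ≤ n) : cut n k (Fin.last n) = Fin.last 1 := by
  simp [cut, hk]

theorem cut_surjective {n k : ℕ} (h₁ : 1 ≤ k) (hk : k ≤ n) : Function.Surjective (cut n k) := by
  intro i
  fin_cases i
  · exact ⟨0, if_pos (by simp; omega)⟩
  · exact ⟨Fin.last n, cut_last hk⟩

/-- The canonical homomorphism of `J_n` onto a member of the family. -/
def proj (n : ℕ) : ∀ x, J n →[sig n] Fam n x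
  | none => homOfMapFun (B := J0 n) (JSet.relabel fun _ => 0)
      fun l F x => relabel_funMap (m := 0) monotone_const rfl l F x
  | some k => homOfMapFun (B := J1 n (k + 1)) (JSet.relabel (cut n (k + 1)))
      fun l F x => relabel_funMap (cut_monotone n (k + 1)) (cut_last k.2) l F x

theorem proj_surjective (n : ℕ) : ∀ x, Function.Surjective (proj n x)
  | none => relabel_surjective (m := 0) fun i => ⟨0, Subsingleton.elim (α := Fin 1) _ _⟩
  | some k => relabel_surjective (cut_surjective (by omega) k.2)

theorem cut_eq_of_lt {n : ℕ} {k : Fin n} {i j : Fin (n + 1)}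
    (h : cut n (k + 1) i ≠ cut n (k + 1) j) (hij : i ≤ j) : i ≤ k.castSucc ∧ k.succ ≤ j := by
  have : (i : ℕ) ≤ j := hij
  unfold cut at h
  rw [Fin.le_def, Fin.le_def, Fin.val_castSucc, Fin.val_succ]
  split_ifs at h <;> omega

/-- By convexity, any related pair on opposite sides of the cut forces the adjacent pair at the cut.
This pair therefore represents the monolith of `J1 n (k + 1)`. -/
theorem rel_f_of_cut_ne {n : ℕ} {ψ : Setoid (J n)} (h : IsCongruence (sig n) ψ) {k : Fin n}
    {i j : Fin (n + 1)} (hij : ψ (JSet.f i) (JSet.f j))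
    (hne : cut n (k + 1) i ≠ cut n (k + 1) j) : ψ (JSet.f k.castSucc) (JSet.f k.succ) := by
  rcases le_total i j with hle | hle
  · obtain ⟨h₁, h₂⟩ := cut_eq_of_lt hne hle
    exact rel_f_convex h hij h₁ (Fin.castSucc_lt_succ).le h₂
  · obtain ⟨h₁, h₂⟩ := cut_eq_of_lt hne.symm hle
    exact rel_f_convex h (ψ.symm hij) h₁ (Fin.castSucc_lt_succ).le h₂

/-- Each member of the family has a monolith. -/
theorem exists_monolith (n : ℕ) (x : Option (Fin n)) :
    ∃ p q : J n, proj n x p ≠ proj n x q ∧ ∀ ψ : Setoid (J n), IsCongruence (sig n) ψ →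
      ∀ a b : J n, ψ a b → proj n x a ≠ proj n x b → ψ p q := by
  cases x with
  | none =>
    refine ⟨JSet.top, JSet.bot, fun h => JSet.noConfusion rfl (heq_of_eq h), ?_⟩
    intro ψ hψ a b hab hne
    rcases rel_cases hψ hab with rfl | h | ⟨i, j, rfl, rfl⟩ | ⟨i, j, rfl, rfl⟩
    · exact absurd rfl hne
    · exact h
    · exact absurd rfl hne
    · exact absurd rfl hne
  | some k =>
    refine ⟨JSet.f k.castSucc, JSet.f k.succ, ?_, ?_⟩
    · intro h
      have h' : cut n (k + 1) k.castSucc = cut n (k + 1) k.succ := JSet.f.inj h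
      simp [cut] at h'
    intro ψ hψ a b hab hne
    rcases rel_cases hψ hab with rfl | h | ⟨i, j, rfl, rfl⟩ | ⟨i, j, rfl, rfl⟩
    · exact absurd rfl hne
    · exact rel_of_top_bot hψ h _ _
    · exact rel_f_of_cut_ne hψ hab fun h => hne (congrArg JSet.f h)
    · exact rel_f_of_cut_ne hψ (rel_f_of_rel_t hψ hab) fun h => hne (congrArg JSet.t h)

theorem exists_cut {n : ℕ} {ψ : Setoid (J n)} {i j : Fin (n + 1)} (hij : i ≤ j)
    (h : ¬ ψ (JSet.f i) (JSet.f j)) :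
    ∃ k : Fin n, i ≤ k.castSucc ∧ k.succ ≤ j ∧ ¬ ψ (JSet.f k.castSucc) (JSet.f k.succ) := by
  by_contra! hcon
  apply h
  have key : ∀ l : ℕ, ∀ hl : l < n + 1, (i : ℕ) ≤ l → l ≤ j → ψ (JSet.f i) (JSet.f ⟨l, hl⟩) := by
    intro l
    induction l with
    | zero =>
      intro hl h₁ _
      have : i = ⟨0, hl⟩ := Fin.ext (by simpa using h₁)
      rw [← this]
      exact ψ.refl _
    | succ l ih =>
      intro hl h₁ h₂
      rcases Nat.lt_or_ge l i with h₃ | h₃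
      · have : i = ⟨l + 1, hl⟩ := Fin.ext (by simp; omega)
        rw [← this]
        exact ψ.refl _
      · exact ψ.trans (ih (by omega) h₃ (by omega))
          (hcon ⟨l, by omega⟩ (Fin.le_def.mpr h₃) (Fin.le_def.mpr h₂))
  exact key j j.2 hij le_rfl

/-- Every congruence on `J_n` is an intersection of kernels of canonical homomorphisms. -/
theorem exists_proj {n : ℕ} {ψ : Setoid (J n)} (hψ : IsCongruence (sig n) ψ) {a b : J n}
    (hab : ¬ ψ a b) :
    ∃ x, (∀ c d, ψ c d → proj n x c = proj n x d) ∧ proj n x a ≠ proj n x b := by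
  have htb : ¬ ψ JSet.top JSet.bot := fun h => hab (rel_of_top_bot hψ h a b)
  by_cases hne : proj n none a = proj n none b
  -- Here `a` and `b` are on the same chain, so the map must cut between their indices at an
  -- adjacent pair that `ψ` keeps apart; convexity puts `ψ` below its kernel.
  · have hf : ∀ i j : Fin (n + 1), i ≤ j → ¬ ψ (JSet.f i) (JSet.f j) →
        ∃ k : Fin n, (∀ c d, ψ c d → proj n (some k) c = proj n (some k) d) ∧
          cut n (k + 1) i ≠ cut n (k + 1) j := by
      intro i j hij h
      obtain ⟨k, h₁, h₂, h₃⟩ := exists_cut hij h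
      refine ⟨k, ?_, ?_⟩
      · intro c d hcd
        by_contra hne'
        rcases rel_cases hψ hcd with rfl | h | ⟨i, j, rfl, rfl⟩ | ⟨i, j, rfl, rfl⟩
        · exact hne' rfl
        · exact htb h
        · exact h₃ (rel_f_of_cut_ne hψ hcd fun h => hne' (congrArg JSet.f h))
        · exact h₃ (rel_f_of_cut_ne hψ (rel_f_of_rel_t hψ hcd) fun h => hne' (congrArg JSet.t h))
      · rw [Fin.le_def, Fin.val_castSucc] at h₁
        rw [Fin.le_def, Fin.val_succ] at h₂
        unfold cut
        rw [if_pos (by omega), if_neg (by omega)]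
        simp
    have hf' : ∀ i j : Fin (n + 1), ¬ ψ (JSet.f i) (JSet.f j) →
        ∃ k : Fin n, (∀ c d, ψ c d → proj n (some k) c = proj n (some k) d) ∧
          cut n (k + 1) i ≠ cut n (k + 1) j := by
      intro i j h
      rcases le_total i j with hle | hle
      · exact hf i j hle h
      · obtain ⟨k, h₁, h₂⟩ := hf j i hle fun h' => h (ψ.symm h')
        exact ⟨k, h₁, h₂.symm⟩
    change JSet.relabel (fun _ => (0 : Fin 1)) a = JSet.relabel (fun _ => (0 : Fin 1)) b at hne
    cases a with
    | top => cases b <;> first | exact absurd (ψ.refl _) hab | exact absurd hne (by simp [JSet.relabel])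
    | bot => cases b <;> first | exact absurd (ψ.refl _) hab | exact absurd hne (by simp [JSet.relabel])
    | f i =>
      cases b with
      | top => exact absurd hne (by simp [JSet.relabel])
      | bot => exact absurd hne (by simp [JSet.relabel])
      | t j => exact absurd hne (by simp [JSet.relabel])
      | f j =>
        obtain ⟨k, h₁, h₂⟩ := hf' i j hab
        exact ⟨some k, h₁, fun h => h₂ (JSet.f.inj h)⟩
    | t i =>
      cases b with
      | top => exact absurd hne (by simp [JSet.relabel])
      | bot => exact absurd hne (by simp [JSet.relabel])
      | f j => exact absurd hne (by simp [JSet.relabel])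
      | t j =>
        obtain ⟨k, h₁, h₂⟩ := hf' i j fun h => hab (rel_t_of_rel_f hψ h)
        exact ⟨some k, h₁, fun h => h₂ (JSet.t.inj h)⟩
  · refine ⟨none, ?_, hne⟩
    intro c d hcd
    rcases rel_cases hψ hcd with rfl | h | ⟨i, j, rfl, rfl⟩ | ⟨i, j, rfl, rfl⟩
    · rfl
    · exact absurd h htb
    · rfl
    · rfl

/-- The elements of `J_n` as a disjoint union. -/
def jsetEquiv (n : ℕ) : JSet n ≃ Bool ⊕ (Fin (n + 1) ⊕ Fin (n + 1)) where
  toFun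
    | .top => .inl true
    | .bot => .inl false
    | .f i => .inr (.inl i)
    | .t i => .inr (.inr i)
  invFun
    | .inl true => .top
    | .inl false => .bot
    | .inr (.inl i) => .f i
    | .inr (.inr i) => .t i
  left_inv := by rintro (_ | _ | _ | _) <;> rfl
  right_inv := by rintro ((_ | _) | (_ | _)) <;> rfl

instance (n : ℕ) : Finite (JSet n) := Finite.of_equiv _ (jsetEquiv n).symm

instance (n : ℕ) : Finite (J n) := inferInstanceAs (Finite (JSet n))

theorem card_jset (n : ℕ) : Nat.card (JSet n) = 2 * (n + 1) + 2 := by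
  rw [Nat.card_congr (jsetEquiv n)]
  simp
  ring

/-! ### The majority term. -/

section Maj

/-- The majority term of a lattice, built from `∧` and `∨`. -/
def maj (n : ℕ) {A : Type*} [(sig n).Structure A] (x y z : A) : A :=
  let meet (a b : A) : A := Language.Structure.funMap (L := sig n) (Ops.wedge : Ops n 2) ![a, b]
  let join (a b : A) : A := Language.Structure.funMap (L := sig n) (Ops.vee : Ops n 2) ![a, b]
  join (join (meet x y) (meet y z)) (meet z x)

variable {n : ℕ} {A : Type*} [(sig n).Structure A]

theorem maj_congr {θ : Setoid A} (h : IsCongruence (sig n) θ) {x x' y y' z z' : A} (hx : θ x x')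
    (hy : θ y y') (hz : θ z z') : θ (maj n x y z) (maj n x' y' z') := by
  have h₂ (F : Ops n 2) {a a' b b' : A} (ha : θ a a') (hb : θ b b') :
      θ (Language.Structure.funMap (L := sig n) F ![a, b])
        (Language.Structure.funMap (L := sig n) F ![a', b']) :=
    h 2 F _ _ (by intro j; fin_cases j <;> assumption)
  exact h₂ _ (h₂ _ (h₂ _ hx hy) (h₂ _ hy hz)) (h₂ _ hz hx)

theorem map_funMap₂ {B : Type*} [(sig n).Structure B] (g : A →[sig n] B) (F : Ops n 2) (a b : A) :
    g (Language.Structure.funMap (L := sig n) F ![a, b]) =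
      Language.Structure.funMap (L := sig n) F ![g a, g b] := by
  refine (g.map_fun (L := sig n) F _).trans ?_
  congr 1
  funext j
  fin_cases j <;> rfl

theorem map_maj {B : Type*} [(sig n).Structure B] (g : A →[sig n] B) (x y z : A) :
    g (maj n x y z) = maj n (g x) (g y) (g z) := by
  simp only [maj, map_funMap₂]

theorem isMajority_jset (x y : J n) : maj n x x y = x ∧ maj n x y x = x ∧ maj n x y y = y := by
  change JSet.joinT (JSet.joinT (JSet.meetT x x) (JSet.meetT x y)) (JSet.meetT y x) = x ∧
    JSet.joinT (JSet.joinT (JSet.meetT x y) (JSet.meetT y x)) (JSet.meetT x x) = x ∧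
    JSet.joinT (JSet.joinT (JSet.meetT x y) (JSet.meetT y y)) (JSet.meetT y x) = y
  have le (a b c d : JSet n) (h : JSet.leT d (JSet.joinT (JSet.joinT a b) c))
      (ha : JSet.leT a d) (hb : JSet.leT b d) (hc : JSet.leT c d) :
      JSet.joinT (JSet.joinT a b) c = d :=
    JSet.leT_antisymm _ _ ((JSet.joinT_leT_iff _ _ _).2 ⟨(JSet.joinT_leT_iff _ _ _).2 ⟨ha, hb⟩, hc⟩) h
  have ml (a b : JSet n) : JSet.leT (JSet.meetT a b) a :=
    ((JSet.leT_meetT_iff a b _).1 (JSet.leT_refl _)).1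
  have mr (a b : JSet n) : JSet.leT (JSet.meetT a b) b :=
    ((JSet.leT_meetT_iff a b _).1 (JSet.leT_refl _)).2
  have jl (a b : JSet n) : JSet.leT a (JSet.joinT a b) :=
    ((JSet.joinT_leT_iff a b _).1 (JSet.leT_refl _)).1
  have jr (a b : JSet n) : JSet.leT b (JSet.joinT a b) :=
    ((JSet.joinT_leT_iff a b _).1 (JSet.leT_refl _)).2
  have idem (a : JSet n) : JSet.leT a (JSet.meetT a a) :=
    (JSet.leT_meetT_iff a a _).2 ⟨JSet.leT_refl _, JSet.leT_refl _⟩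
  have tr := JSet.leT_trans (n := n)
  refine ⟨le _ _ _ _ ?_ (ml _ _) (ml _ _) (mr _ _), le _ _ _ _ ?_ (ml _ _) (mr _ _) (mr _ _),
    le _ _ _ _ ?_ (mr _ _) (ml _ _) (ml _ _)⟩
  · exact tr _ _ _ (idem x) (tr _ _ _ (jl _ _) (jl _ _))
  · exact tr _ _ _ (idem x) (jr _ _)
  · exact tr _ _ _ (idem y) (tr _ _ _ (jr _ _) (jl _ _))

end Maj

/-! ### Separation and extension of homomorphisms in the variety. -/

section Variety

variable {n : ℕ}

/-- The majority identities pass from `J n` to powers, subalgebras and images. -/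
theorem InV.isMajority {A : Type u} [(sig n).Structure A] (hA : InV n A) :
    IsMajority (sig n) (maj n : A → A → A → A) := by
  obtain ⟨I, S, f, hf⟩ := hA
  have ev (i : I) : ∃ e : S →[sig n] J n, ∀ s : S, e s = s.1 i :=
    ⟨homOfMapFun (fun s => s.1 i) fun _ _ _ => rfl, fun _ => rfl⟩
  have hS (x y : S) : maj n x x y = x ∧ maj n x y x = x ∧ maj n x y y = y := by
    refine ⟨?_, ?_, ?_⟩ <;>
    · apply Subtype.ext
      funext i
      obtain ⟨e, he⟩ := ev i
      rw [← he, ← he, map_maj]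
      first
        | exact (isMajority_jset _ _).1
        | exact (isMajority_jset _ _).2.1
        | exact (isMajority_jset _ _).2.2
  have hA (x y : A) : maj n x x y = x ∧ maj n x y x = x ∧ maj n x y y = y := by
    obtain ⟨s, rfl⟩ := hf x
    obtain ⟨t, rfl⟩ := hf y
    refine ⟨?_, ?_, ?_⟩
    · rw [← map_maj, (hS s t).1]
    · rw [← map_maj, (hS s t).2.1]
    · rw [← map_maj, (hS s t).2.2]
  exact ⟨fun x y => (hA x y).1, fun x y => (hA x y).2.1, fun x y => (hA x y).2.2,
    fun θ h _ _ _ _ _ _ => maj_congr h⟩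

/-- If `f` presents `B` as an image of a subalgebra of a power, the preimage under `f` of the range
of `g` is a subalgebra of the same power that maps onto `A`. -/
theorem InV.of_injective {A : Type u} {B : Type u} [(sig n).Structure A] [(sig n).Structure B]
    (hB : InV n B) (g : A →[sig n] B) (hg : Function.Injective g) : InV n A := by
  obtain ⟨I, S, f, hf⟩ := hB
  let T : (sig n).Substructure S := g.range.comap f
  let T' : (sig n).Substructure (I → J n) := T.map S.subtype.toHom
  have hT (s : T') : ∃ h : s.1 ∈ S, ∃ a, g a = f ⟨s.1, h⟩ := by
    obtain ⟨s, t, ht, rfl⟩ := s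
    exact ⟨t.2, ht⟩
  choose hmem a ha using hT
  refine ⟨I, T', homOfMapFun a ?_, ?_⟩
  · intro m F x
    apply hg
    rw [ha, g.map_fun]
    have : g ∘ (a ∘ x) = f ∘ fun j => ⟨(x j).1, hmem (x j)⟩ := funext fun j => ha (x j)
    rw [this, ← f.map_fun]
    rfl
  · intro b
    obtain ⟨s, hs⟩ := hf (g b)
    refine ⟨⟨s.1, s, ⟨b, hs.symm⟩, rfl⟩, ?_⟩
    apply hg
    rw [homOfMapFun_apply, ha]
    exact hs

theorem funMap_const (c : JSet n) :
    Language.Structure.funMap (L := sig n) (M := J n) (Ops.const c : Ops n 0) ![] = c := by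
  change JSet.relabel id c = c
  cases c <;> rfl

theorem hom_const {A : Type*} [(sig n).Structure A] (g : J n →[sig n] A) (c : J n) :
    g c = Language.Structure.funMap (L := sig n) (Ops.const c : Ops n 0) ![] := by
  refine (congrArg g (funMap_const c).symm).trans ((g.map_fun (L := sig n) _ _).trans ?_)
  congr 1
  exact Subsingleton.elim _ _

/-- Every element of `J n` is named by a constant, so `J n` admits at most one homomorphism to any
algebra. -/
theorem hom_ext {A : Type*} [(sig n).Structure A] (g h : J n →[sig n] A) (c : J n) : g c = h c := by
  rw [hom_const, hom_const]

theorem InV.exists_hom {A : Type u} [(sig n).Structure A] (hA : InV n A) :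
    Nonempty (J n →[sig n] A) := by
  obtain ⟨I, S, f, hf⟩ := hA
  have hmem (c : J n) : (fun _ => c) ∈ S := by
    have h := S.fun_mem (Ops.const c : Ops n 0) ![] (fun j => j.elim0)
    have heq : Language.Structure.funMap (L := sig n) (M := I → J n) (Ops.const c : Ops n 0) ![] =
        fun _ => c := funext fun _ => funMap_const c
    exact heq ▸ h
  exact ⟨f.comp (homOfMapFun (fun c => ⟨fun _ => c, hmem c⟩) fun _ _ _ => rfl)⟩

/-- Every congruence on a member of the variety is an intersection of kernels of homomorphisms
into the members of the family. -/
theorem InV.exists_hom_ne {A : Type u} [(sig n).Structure A] (hA : InV n A) {θ : Setoid A}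
    (hθ : IsCongruence (sig n) θ) {a b : A} (hab : ¬ θ a b) :
    ∃ (x : Option (Fin n)) (h : A →[sig n] Fam n x), (∀ c d, θ c d → h c = h d) ∧ h a ≠ h b := by
  have hS : ∃ (I : Type u) (S : (sig n).Substructure (I → J n)) (f : S →[sig n] A),
    Function.Surjective f := hA
  obtain ⟨I, S, f, hf⟩ := hS
  have hSV : InV n S := ⟨I, S, Language.Hom.id _ _, fun s => ⟨s, rfl⟩⟩
  obtain ⟨κ⟩ := hSV.exists_hom
  obtain ⟨s, rfl⟩ := hf a
  obtain ⟨t, rfl⟩ := hf b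
  -- Maximality makes `ψ` meet-irreducible: any congruence strictly above it relates `s` and `t`.
  obtain ⟨ψ, hψ, hle, hst, hmax⟩ := (hθ.comap f).exists_maximal (a := s) (b := t) hab
  let e (i : I) : S →[sig n] J n := homOfMapFun (fun s => s.1 i) fun _ _ _ => rfl
  obtain ⟨U, hU⟩ := hSV.isMajority.exists_ultrafilter (fun i => isCongruence_ker (e i)) hψ (by
      intro α β hα hβ h₁ h₂ h₃
      by_contra! hcon
      have h₄ : α s t := by
        by_contra h
        exact hcon.1 (hmax α hα h₁ h)
      have h₅ : β s t := by
        by_contra h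
        exact hcon.2 (hmax β hβ h₂ h)
      exact hst (h₃ ⟨h₄, h₅⟩)) ⟨s, t, hst⟩ (by
      intro p q h
      have : p = q := Subtype.ext (funext fun i => h i)
      exact this ▸ ψ.refl p)
  have hκ (c : J n) (i : I) : e i (κ c) = c := hom_ext ((e i).comp κ) (Language.Hom.id _ _) c
  -- Each `s` agrees almost everywhere with a constant tuple `κ c`, so `κ` meets every `ψ`-class and
  -- `ψ` can be studied on `J n`.
  have hex (s : S) : ∃ c, ψ s (κ c) ∧ ∀ᶠ i in (U : Filter I), e i s = c := by
    obtain ⟨_, -, h⟩ := exists_limit_hom U (fun _ => Language.Hom.id (sig n) (J n))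
      (fun _ c => ⟨c, rfl⟩) e (Language.Hom.id _ _)
      (fun c c' h => by obtain ⟨i, hi⟩ := h.exists; exact hi)
    obtain ⟨c, hc⟩ := h s
    refine ⟨c, hU _ _ ?_, hc⟩
    filter_upwards [hc] with i hi
    rw [Setoid.ker_def, hκ]
    exact hi
  obtain ⟨c, hc, -⟩ := hex s
  obtain ⟨d, hd, -⟩ := hex t
  obtain ⟨x, hx, hne⟩ := exists_proj (hψ.comap κ) (a := c) (b := d)
    (fun h => hst (ψ.trans hc (ψ.trans h (ψ.symm hd))))
  obtain ⟨k, hk, -⟩ := exists_limit_hom U (fun _ => Language.Hom.id (sig n) (J n))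
      (fun _ c => ⟨c, rfl⟩) e (proj n x)
      (fun c c' h => by obtain ⟨i, hi⟩ := h.exists; exact congrArg _ hi)
  have hk' {s : S} {c : J n} (h : ψ s (κ c)) : k s = proj n x c := by
    obtain ⟨d, hd, hU'⟩ := hex s
    rw [hk s d hU']
    exact hx _ _ (ψ.trans (ψ.symm hd) h)
  have hkψ {s t : S} (h : ψ s t) : k s = k t := by
    obtain ⟨d, hd, -⟩ := hex t
    rw [hk' hd, hk' (ψ.trans h hd)]
  -- `ψ` contains the pullback of `θ` along `f`, hence the kernel of `f`, so `k` descends to `A`.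
  obtain ⟨g, hg⟩ := exists_factor f hf k fun p q h => hkψ (hle (by
    rw [Setoid.comap_rel, h]))
  refine ⟨x, g, ?_, ?_⟩
  · intro p q hpq
    obtain ⟨p, rfl⟩ := hf p
    obtain ⟨q, rfl⟩ := hf q
    rw [hg, hg]
    exact hkψ (hle hpq)
  · rw [hg, hg, hk' hc, hk' hd]
    exact hne

theorem InV.exists_hom_ne_of_ne {A : Type u} [(sig n).Structure A] (hA : InV n A) {a b : A}
    (hab : a ≠ b) : ∃ (x : Option (Fin n)) (h : A →[sig n] Fam n x), h a ≠ h b := by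
  obtain ⟨x, h, -, hne⟩ := hA.exists_hom_ne (θ := ⊥) (a := a) (b := b) (by
    intro m F x y hxy
    have : x = y := funext hxy
    exact this ▸ (⊥ : Setoid A).refl _) hab
  exact ⟨x, h, hne⟩

/-- A homomorphism into a member of the family extends along embeddings in the variety. -/
theorem exists_extension {A : Type u} {B : Type u} [(sig n).Structure A] [(sig n).Structure B]
    (hB : InV n B) (g : A ↪[sig n] B) {x : Option (Fin n)} (h : A →[sig n] Fam n x) :
    ∃ k : B →[sig n] Fam n x, ∀ a, k (g a) = h a := by
  have hA : InV n A := hB.of_injective g.toHom g.injective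
  obtain ⟨κ⟩ := hA.exists_hom
  have hκ (c : J n) : h (κ c) = proj n x c := hom_ext (h.comp κ) (proj n x) c
  let I := Σ y, B →[sig n] Fam n y
  obtain ⟨p, q, hpq, hmono⟩ := exists_monolith n x
  -- Anything strictly above `ker h` contains the monolith pair, so two such congruences cannot meet
  -- inside `ker h`.
  have hbig {α : Setoid A} (hα : IsCongruence (sig n) α) (hle : Setoid.ker h ≤ α)
      (hn : ¬ α ≤ Setoid.ker h) : α (κ p) (κ q) := by
    have : ∃ a b, α a b ∧ h a ≠ h b := by
      by_contra! hcon
      exact hn fun {a b} hab => hcon a b hab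
    obtain ⟨a, b, hab, hne⟩ := this
    obtain ⟨c, hc⟩ := proj_surjective n x (h a)
    obtain ⟨d, hd⟩ := proj_surjective n x (h b)
    refine hmono _ (hα.comap κ) c d ?_ (by rwa [hc, hd])
    have h₁ : α (κ c) a := hle (by rw [Setoid.ker_def, hκ, hc])
    have h₂ : α (κ d) b := hle (by rw [Setoid.ker_def, hκ, hd])
    exact α.trans h₁ (α.trans hab (α.symm h₂))
  obtain ⟨U, hU⟩ := hA.isMajority.exists_ultrafilter (I := I)
    (fun i => isCongruence_ker (i.2.comp g.toHom)) (isCongruence_ker h) (by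
      intro α β hα hβ h₁ h₂ h₃
      by_contra! hcon
      have h₄ : h (κ p) = h (κ q) := h₃ ⟨hbig hα h₁ hcon.1, hbig hβ h₂ hcon.2⟩
      rw [hκ, hκ] at h₄
      exact hpq h₄) ⟨κ p, κ q, by rwa [Setoid.ker_def, hκ, hκ]⟩ (by
      intro a b hab
      have : a = b := by
        by_contra hne
        obtain ⟨y, e, he⟩ := hB.exists_hom_ne_of_ne fun h => hne (g.injective h)
        exact he (hab ⟨y, e⟩)
      rw [this])
  have hi (i : I) (c : J n) : i.2 (g (κ c)) = proj n i.1 c :=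
    hom_ext (i.2.comp (g.toHom.comp κ)) (proj n i.1) c
  -- The targets vary with `i`, but all are quotients of `J n`, so values are compared through
  -- representatives `c : J n`.
  obtain ⟨k, hk, hex⟩ := exists_limit_hom U (fun i : I => proj n i.1)
    (fun i => proj_surjective n i.1) (fun i => i.2) (proj n x) (by
      intro c c' hcc
      rw [← hκ, ← hκ]
      refine hU _ _ ?_
      filter_upwards [hcc] with i h'
      rw [← hi, ← hi] at h'
      exact h')
  refine ⟨k, fun a => ?_⟩
  obtain ⟨c, hc⟩ := hex (g a)
  rw [hk _ c hc, ← hκ]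
  refine (hU _ _ ?_).symm
  filter_upwards [hc] with i h'
  rw [← hi] at h'
  exact h'

end Variety

end DefaultBilattice

namespace UnivAlg

/-- A bijective homomorphism of algebras is an isomorphism. -/
noncomputable def equivOfBijective {L : FirstOrder.Language.{0, 0}} [L.IsAlgebraic] {A B : Type*}
    [L.Structure A] [L.Structure B] (f : A →[L] B) (hf : Function.Bijective f) : A ≃[L] B where
  toEquiv := Equiv.ofBijective f hf
  map_fun' F x := f.map_fun F x
  map_rel' r _ := isEmptyElim r

end UnivAlg

/-! ### Classification of the subdirectly irreducible algebras. -/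

namespace DefaultBilattice

variable {n : ℕ}

theorem inV_of_surjective {A : Type u} [(sig n).Structure A] (r : J n →[sig n] A)
    (hr : Function.Surjective r) : InV n A := by
  refine ⟨PUnit, ⊤, homOfMapFun (fun s => r (s.1 PUnit.unit)) ?_, ?_⟩
  · intro m F x
    exact r.map_fun F fun j => (x j).1 PUnit.unit
  · intro a
    obtain ⟨c, rfl⟩ := hr a
    exact ⟨⟨fun _ => c, trivial⟩, rfl⟩

/-- A quotient of `J_n` with the same kernel as a member of the family is subdirectly
irreducible. -/
theorem subdirectlyIrreducible_of_ker {A : Type u} [(sig n).Structure A] (r : J n →[sig n] A)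
    (hr : Function.Surjective r) {x : Option (Fin n)}
    (hx : ∀ c d, r c = r d ↔ proj n x c = proj n x d) : SubdirectlyIrreducible (sig n) A := by
  obtain ⟨p, q, hpq, hmono⟩ := exists_monolith n x
  have hne : r p ≠ r q := fun h => hpq ((hx p q).1 h)
  refine ⟨⟨r p, r q, hne⟩, ?_⟩
  intro I B _ f hf hinj
  obtain ⟨i, hi⟩ : ∃ i, f i (r p) ≠ f i (r q) := by
    by_contra! h
    exact hne (hinj _ _ h)
  refine ⟨i, ?_, hf i⟩
  intro a b hab
  obtain ⟨c, rfl⟩ := hr a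
  obtain ⟨d, rfl⟩ := hr b
  by_contra h
  exact hi (hmono _ (isCongruence_ker ((f i).comp r)) c d hab fun h' => h ((hx c d).2 h'))

theorem exists_equiv_of_subdirectlyIrreducible {A : Type u} [(sig n).Structure A] (hA : InV n A)
    (hsi : SubdirectlyIrreducible (sig n) A) : ∃ x, Nonempty (A ≃[sig n] Fam n x) := by
  let I := Σ y, A →[sig n] Fam n y
  -- `SubdirectlyIrreducible` tests factors in `Type u`, whereas the family lives in `Type`.
  let str (i : I) : (sig n).Structure (ULift.{u} (Fam n i.1)) :=
    Equiv.inducedStructure Equiv.ulift.symm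
  obtain ⟨κ⟩ := hA.exists_hom
  have hsurj (i : I) : Function.Surjective i.2 := by
    intro e
    obtain ⟨c, rfl⟩ := proj_surjective n i.1 e
    exact ⟨κ c, hom_ext (i.2.comp κ) (proj n i.1) c⟩
  obtain ⟨i, hi⟩ := hsi.2 I (fun i => ULift.{u} (Fam n i.1))
    (fun i => homOfMapFun (fun a => ULift.up (i.2 a)) fun m F x =>
      congrArg ULift.up (i.2.map_fun F x))
    (fun i ⟨e⟩ => (hsurj i e).imp fun a ha => congrArg ULift.up ha)
    (fun a b hab => by
      by_contra hne
      obtain ⟨y, e, he⟩ := hA.exists_hom_ne_of_ne hne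
      exact he (congrArg ULift.down (hab ⟨y, e⟩)))
  exact ⟨i.1, ⟨equivOfBijective i.2 ⟨fun a b hab => hi.1 (congrArg ULift.up hab), hsurj i⟩⟩⟩

/-- The members of the family are, up to isomorphism, the subdirectly irreducible algebras in
the variety. -/
theorem subdirectlyIrreducible_iff (A : Type u) [(sig n).Structure A] :
    (InV n A ∧ SubdirectlyIrreducible (sig n) A) ↔ ∃ x, Nonempty (A ≃[sig n] Fam n x) := by
  constructor
  · rintro ⟨hA, hsi⟩
    exact exists_equiv_of_subdirectlyIrreducible hA hsi
  · rintro ⟨x, ⟨e⟩⟩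
    have hr : Function.Surjective (e.symm.toHom.comp (proj n x)) :=
      e.symm.surjective.comp (proj_surjective n x)
    exact ⟨inV_of_surjective _ hr, subdirectlyIrreducible_of_ker _ hr
      fun c d => e.symm.injective.eq_iff⟩

theorem exists_fam_iff (P : ∀ (E : Type) [(sig n).Structure E], Prop) :
    (∃ x, P (Fam n x)) ↔ P (J0 n) ∨ ∃ k ∈ Set.Icc 1 n, P (J1 n k) := by
  constructor
  · rintro ⟨_ | k, h⟩
    · exact Or.inl h
    · exact Or.inr ⟨k + 1, ⟨by omega, k.2⟩, h⟩
  · rintro (h | ⟨k, ⟨h₁, h₂⟩, h⟩)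
    · exact ⟨none, h⟩
    · obtain ⟨j, rfl⟩ := Nat.exists_eq_add_of_le' h₁
      exact ⟨some ⟨j, h₂⟩, h⟩

theorem isInjectiveInV_fam (n : ℕ) (x : Option (Fin n)) : IsInjectiveInV.{u, 0} n (Fam n x) :=
  ⟨inV_of_surjective _ (proj_surjective n x), fun _ _ _ _ _ hB g h => exists_extension hB g h⟩

/-! ### Injective hulls by products, congruence extension and amalgamation. -/

/-- A product of members of the family. -/
def FamProd (n : ℕ) {ι : Type u} (x : ι → Option (Fin n)) : Type u := ∀ i, Fam n (x i)

instance {ι : Type u} (x : ι → Option (Fin n)) : (sig n).Structure (FamProd n x) where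
  funMap F y := fun i => Language.Structure.funMap F fun j => y j i
  RelMap r _ := isEmptyElim r

/-- The homomorphism into a product with the given coordinates. -/
def FamProd.lift {ι : Type u} {x : ι → Option (Fin n)} {A : Type*} [(sig n).Structure A]
    (f : ∀ i, A →[sig n] Fam n (x i)) : A →[sig n] FamProd n x :=
  homOfMapFun (fun a i => f i a) fun _ F y => funext fun i => (f i).map_fun F y

/-- A coordinate projection of a product. -/
def FamProd.eval {ι : Type u} (x : ι → Option (Fin n)) (i : ι) : FamProd n x →[sig n] Fam n (x i) :=
  homOfMapFun (fun y => y i) fun _ _ _ => rfl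

theorem FamProd.inV {ι : Type u} (x : ι → Option (Fin n)) : InV n (FamProd n x) := by
  refine ⟨ι, ⊤, FamProd.lift fun i => (proj n (x i)).comp (homOfMapFun (fun s => s.1 i)
    fun _ _ _ => rfl), ?_⟩
  intro y
  choose s hs using fun i => proj_surjective n (x i) (y i)
  exact ⟨⟨s, trivial⟩, funext hs⟩

theorem FamProd.isInjectiveInV {ι : Type u} (x : ι → Option (Fin n)) :
    IsInjectiveInV.{u, u} n (FamProd n x) := by
  refine ⟨FamProd.inV x, fun A B _ _ _ hB g h => ?_⟩
  choose k hk using fun i => exists_extension hB g ((FamProd.eval x i).comp h)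
  exact ⟨FamProd.lift k, fun a => funext fun i => hk i a⟩

theorem InV.exists_injective {A : Type u} [(sig n).Structure A] (hA : InV n A) :
    ∃ (E : Type u) (_ : (sig n).Structure E),
      IsInjectiveInV.{u, u} n E ∧ Nonempty (A ↪[sig n] E) := by
  let I := Σ y, A →[sig n] Fam n y
  refine ⟨FamProd n fun i : I => i.1, inferInstance, FamProd.isInjectiveInV _,
    ⟨Language.Embedding.ofInjective (f := FamProd.lift fun i : I => i.2) ?_⟩⟩
  intro a b hab
  by_contra hne
  obtain ⟨y, e, he⟩ := hA.exists_hom_ne_of_ne hne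
  exact he (congrFun hab ⟨y, e⟩)

/-- The extension of `θ` is the common kernel of all homomorphisms from `B` to the family that
collapse `θ`. A pair outside `θ` is separated by a homomorphism on `S`, and this extends to `B`. -/
theorem hasCEP (n : ℕ) : HasCEP.{u} (sig n) (J n) := by
  intro B _ hB S θ hθ
  have hS : InV n S := InV.of_injective hB S.subtype.toHom S.subtype.injective
  let T := {e : Σ y, B →[sig n] Fam n y // ∀ s t : S, θ s t → e.2 s = e.2 t}
  refine ⟨interOn (fun e : T => Setoid.ker e.1.2) Set.univ,
    isCongruence_interOn (L := sig n) (fun e : T => isCongruence_ker e.1.2) _, fun a b =>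
      ⟨fun hab e _ => ?_, fun h => ?_⟩⟩
  · exact e.2 a b hab
  · by_contra hab
    obtain ⟨y, e, he, hne⟩ := hS.exists_hom_ne hθ hab
    obtain ⟨k, hk⟩ := exists_extension hB S.subtype e
    have hk' (s : S) : k s = e s := hk s
    have := h ⟨⟨y, k⟩, fun s t hst => by simpa only [hk'] using he s t hst⟩ trivial
    rw [Setoid.ker_def] at this
    exact hne (by rw [← hk', ← hk']; exact this)

/-- Each homomorphism from `B` to the family, restricted to `A`, extends to `C`, and conversely. The
product over all such pairs amalgamates: the coordinates in `IB` separate `B`, those in `IC`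
separate `C`. -/
theorem hasAP (n : ℕ) : HasAP.{u} (sig n) (J n) := by
  intro A B C _ _ _ _ hB hC f g
  let IB := Σ y, B →[sig n] Fam n y
  let IC := Σ y, C →[sig n] Fam n y
  choose kC hkC using fun i : IB => exists_extension hC g (i.2.comp f.toHom)
  choose kB hkB using fun i : IC => exists_extension hB f (i.2.comp g.toHom)
  let x : IB ⊕ IC → Option (Fin n)
    | .inl i => i.1
    | .inr i => i.1
  let fB : ∀ i, B →[sig n] Fam n (x i)
    | .inl i => i.2
    | .inr i => kB i
  let fC : ∀ i, C →[sig n] Fam n (x i)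
    | .inl i => kC i
    | .inr i => i.2
  have hfB : Function.Injective (FamProd.lift fB) := by
    intro a b hab
    by_contra hne
    obtain ⟨y, e, he⟩ := InV.exists_hom_ne_of_ne hB hne
    exact he (congrFun hab (.inl ⟨y, e⟩))
  have hfC : Function.Injective (FamProd.lift fC) := by
    intro a b hab
    by_contra hne
    obtain ⟨y, e, he⟩ := InV.exists_hom_ne_of_ne hC hne
    exact he (congrFun hab (.inr ⟨y, e⟩))
  refine ⟨FamProd n x, inferInstance, Language.Embedding.ofInjective hfB,
    Language.Embedding.ofInjective hfC, FamProd.inV x, fun a => funext ?_⟩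
  rintro (i | i)
  · exact (hkC i a).symm
  · exact hkB i a

theorem proj_none_zero_bijective : Function.Bijective (proj 0 none) := by
  refine ⟨fun a b hab => ?_, proj_surjective 0 none⟩
  have key : ∀ a : JSet 0, JSet.relabel (fun _ => (0 : Fin 1)) a = a := by
    rintro (_ | _ | i | i)
    · rfl
    · rfl
    · exact congrArg JSet.f (Subsingleton.elim (α := Fin 1) _ _)
    · exact congrArg JSet.t (Subsingleton.elim (α := Fin 1) _ _)
  exact ((key a).symm.trans hab).trans (key b)

theorem map_const {A B : Type*} [(sig n).Structure A] [(sig n).Structure B] (e : A ≃[sig n] B)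
    (c : JSet n) :
    e (Language.Structure.funMap (L := sig n) (Ops.const c : Ops n 0) ![]) =
      Language.Structure.funMap (L := sig n) (Ops.const c : Ops n 0) ![] := by
  refine (e.map_fun (L := sig n) _ _).trans ?_
  congr 1
  exact Subsingleton.elim _ _

/-- Isomorphisms preserve coincidences between constants, and `k` is recovered from them: the
constants `f_i` and `f_0` have the same value exactly when `i < k`. -/
theorem J1_index_eq {k l : ℕ} (hk : k ∈ Set.Icc 1 n) (hl : l ∈ Set.Icc 1 n)
    (e : J1 n k ≃[sig n] J1 n l) : k = l := by
  have key (i : Fin (n + 1)) : cut n k i = cut n k 0 ↔ cut n l i = cut n l 0 := by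
    have h (i : Fin (n + 1)) : e (JSet.f (cut n k i)) = JSet.f (cut n l i) := map_const e (JSet.f i)
    constructor
    · intro h'
      have := h i
      rw [h'] at this
      exact JSet.f.inj (this.symm.trans (h 0))
    · intro h'
      have := h i
      rw [h'] at this
      exact JSet.f.inj (e.injective (this.trans (h 0).symm))
  have hcut {m : ℕ} (hm : m ∈ Set.Icc 1 n) (i : Fin (n + 1)) :
      cut n m i = cut n m 0 ↔ (i : ℕ) < m := by
    have h0 : ((0 : Fin (n + 1)) : ℕ) < m := hm.1
    unfold cut
    rw [if_pos h0]
    split_ifs with h <;> simp [h]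
  have hlt (i : Fin (n + 1)) : (i : ℕ) < k ↔ (i : ℕ) < l := by
    rw [← hcut hk, ← hcut hl, key]
  have h₁ := hlt ⟨k, by have := hk.2; omega⟩
  have h₂ := hlt ⟨l, by have := hl.2; omega⟩
  simp only at h₁ h₂
  omega

end DefaultBilattice

theorem proposition2p5 :
    -- the subdirectly irreducible algebras in `V_0`
    (∀ (A : Type u) [(sig 0).Structure A],
      (InV 0 A ∧ SubdirectlyIrreducible (sig 0) A) ↔ Nonempty (A ≃[sig 0] J 0)) ∧
    -- the subdirectly irreducible algebras in `V_n`, for `n ≥ 1`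
    (∀ n : ℕ, 1 ≤ n →
      (∀ (A : Type u) [(sig n).Structure A],
        (InV n A ∧ SubdirectlyIrreducible (sig n) A) ↔
          (Nonempty (A ≃[sig n] J0 n) ∨ ∃ k ∈ Set.Icc 1 n, Nonempty (A ≃[sig n] J1 n k))) ∧
      Nat.card (J0 n) = 4 ∧
      (∀ k ∈ Set.Icc 1 n, Nat.card (J1 n k) = 6) ∧
      (∀ k ∈ Set.Icc 1 n, IsEmpty (J0 n ≃[sig n] J1 n k)) ∧
      (∀ k ∈ Set.Icc 1 n, ∀ l ∈ Set.Icc 1 n, Nonempty (J1 n k ≃[sig n] J1 n l) → k = l)) ∧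
    -- these algebras are injective in `V_n`
    (∀ n : ℕ, IsInjectiveInV.{u, 0} n (J0 n) ∧
      ∀ k ∈ Set.Icc 1 n, IsInjectiveInV.{u, 0} n (J1 n k)) ∧
    -- every algebra in `V_n` embeds into an injective algebra in `V_n`
    (∀ (n : ℕ) (A : Type u) [(sig n).Structure A], InV n A →
      ∃ (E : Type u) (_ : (sig n).Structure E),
        IsInjectiveInV.{u, u} n E ∧ Nonempty (A ↪[sig n] E)) ∧
    -- congruence extension property and amalgamation property
    (∀ n : ℕ, HasCEP.{u} (sig n) (J n) ∧ HasAP.{u} (sig n) (J n)) := by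
  refine ⟨fun A _ => ?_, fun n _ => ⟨fun A _ => ?_, card_jset 0,
    fun k _ => card_jset 1, fun k _ => ⟨fun e => ?_⟩,
    fun k hk l hl ⟨e⟩ => J1_index_eq hk hl e⟩, fun n => ⟨isInjectiveInV_fam n none, fun k hk => ?_⟩,
    fun n A _ hA => hA.exists_injective, fun n => ⟨hasCEP n, hasAP n⟩⟩
  · rw [subdirectlyIrreducible_iff]
    let e₀ := equivOfBijective _ proj_none_zero_bijective
    constructor
    · rintro ⟨_ | k, ⟨e⟩⟩
      · exact ⟨e₀.symm.comp e⟩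
      · exact k.elim0
    · rintro ⟨e⟩
      exact ⟨none, ⟨e₀.comp e⟩⟩
  · rw [subdirectlyIrreducible_iff]
    exact exists_fam_iff fun (E : Type) (_ : (sig n).Structure E) => Nonempty (A ≃[sig n] E)
  · have h : Nat.card (J0 n) = Nat.card (J1 n k) := Nat.card_congr e.toEquiv
    have h0 : Nat.card (J0 n) = 4 := card_jset 0
    have h1 : Nat.card (J1 n k) = 6 := card_jset 1
    omega
  · obtain ⟨j, rfl⟩ := Nat.exists_eq_add_of_le' hk.1
    exact isInjectiveInV_fam n (some ⟨j, hk.2⟩)
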